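/- **Proposition 4.3.** Let $G=\mathbb R\rtimes\mathbb R^{+}$ be the group of pairs $(x,y)$, $x\in\mathbb R$, $y>0$, with product $(x,y)(x',y')=(x+yx',yy')$, and let $g$ be the left-invariant Riemannian metric on $G$ for which the left-invariant frame $e_1=y\frac{\partial}{\partial y}$, $e_2=y\frac{\partial}{\partial x}$ is orthonormal, i.e. $g=(dx^2+dy^2)/y^2$. Let $a,b\in\mathbb R$ and let $X=ae_1+be_2$ satisfy $\sqrt{g(X,X)}<1$, so that $F=\alpha+\beta$, with $\alpha(v)=\sqrt{g(v,v)}$ and $\beta(v)=g(X,v)$, is a Randers metric on $G$. Let $f:G\to\mathbb R$ be a smooth function and $\tilde F=e^{f}F$. Then $\tilde F$ is a Douglas metric if and only if $$b\,y\,\frac{\partial f}{\partial y}-a\,y\,\frac{\partial f}{\partial x}=b\qquad\text{everywhere on } G.$$ Here a Finsler metric on an $n$-dimensional manifold is called a Douglas metric if its Douglas tensor $$D_j{}^i{}_{kl}=\frac{\partial^3}{\partial v^j\partial v^k\partial v^l}\Big(G^i-\frac1{n+1}\sum_m\frac{\partial G^m}{\partial v^m}\,v^i\Big)$$ vanishes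 at every point and every nonzero tangent vector $v$, where $G^i=\frac14 g^{il}\big(\frac{\partial^2 F^2}{\partial x^k\partial v^l}v^k-\frac{\partial F^2}{\partial x^l}\big)$ are the spray coefficients of the metric and $(g^{il})$ is the inverse of $\big(\frac12\frac{\partial^2F^2}{\partial v^i\partial v^j}\big)$ (in these two formulas $F$ denotes the Finsler metric under consideration). -/

import Mathlib

open scoped ContDiff

noncomputable section

/-! ### Finsler geometry in coordinates

A Finsler metric over an open set of `ℝⁿ` is a function `F x v` of a point `x` and of a tangent
vector `v = ∑ i, v i • ∂/∂xⁱ`, both given by their coordinates. -/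

/-- The partial derivative `∂φ/∂xⁱ` at `x`. -/
def partialDeriv {n : ℕ} (i : Fin n) (φ : (Fin n → ℝ) → ℝ) (x : Fin n → ℝ) : ℝ :=
  fderiv ℝ φ x (Pi.single i 1)

/-- The fundamental tensor `g_{ij}(x, v) = ½ ∂²(F²)/∂vⁱ∂vʲ`. -/
def fundamentalTensor {n : ℕ} (F : (Fin n → ℝ) → (Fin n → ℝ) → ℝ) (x v : Fin n → ℝ) :
    Matrix (Fin n) (Fin n) ℝ :=
  Matrix.of fun i j =>
    (1 / 2) * partialDeriv i (fun w => partialDeriv j (fun u => F x u ^ 2) w) v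

/-- The spray (geodesic) coefficients
`Gⁱ = ¼ g^{il} (∂²(F²)/∂xᵏ∂vˡ vᵏ - ∂(F²)/∂xˡ)`. -/
def sprayCoeff {n : ℕ} (F : (Fin n → ℝ) → (Fin n → ℝ) → ℝ) (i : Fin n) (x v : Fin n → ℝ) : ℝ :=
  (1 / 4) * ∑ l, (fundamentalTensor F x v)⁻¹ i l *
    ((∑ k, partialDeriv k (fun z => partialDeriv l (fun u => F z u ^ 2) v) x * v k)
      - partialDeriv l (fun z => F z v ^ 2) x)

/-- The components of the Douglas tensor,
`D_j{}^i{}_{kl} = ∂³/∂vʲ∂vᵏ∂vˡ (Gⁱ - (1/(n+1)) (∂Gᵐ/∂vᵐ) vⁱ)`. -/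
def douglasTensor {n : ℕ} (F : (Fin n → ℝ) → (Fin n → ℝ) → ℝ) (i j k l : Fin n)
    (x v : Fin n → ℝ) : ℝ :=
  partialDeriv j (fun v₁ => partialDeriv k (fun v₂ => partialDeriv l (fun v₃ =>
    sprayCoeff F i x v₃
      - (1 / ((n : ℝ) + 1)) * (∑ m, partialDeriv m (fun w => sprayCoeff F m x w) v₃) * v₃ i)
    v₂) v₁) v

/-- `F` is a Douglas metric on `U`: its Douglas tensor vanishes on the slit tangent bundle. -/
def IsDouglasOn {n : ℕ} (U : Set (Fin n → ℝ)) (F : (Fin n → ℝ) → (Fin n → ℝ) → ℝ) : Prop :=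
  ∀ x ∈ U, ∀ v : Fin n → ℝ, v ≠ 0 → ∀ i j k l : Fin n, douglasTensor F i j k l x v = 0

/-! ### The Lie group `ℝ ⋊ ℝ⁺` -/

/-- The action of `ℝ⁺` on the additive group `ℝ` by scaling, `y • x = y x`. -/
def scalingAction : {r : ℝ // 0 < r} →* MulAut (Multiplicative ℝ) where
  toFun r :=
    { toFun := fun x => Multiplicative.ofAdd ((r : ℝ) * x.toAdd)
      invFun := fun x => Multiplicative.ofAdd ((r : ℝ)⁻¹ * x.toAdd)
      left_inv := fun x => by
        have h : (r : ℝ) ≠ 0 := r.2.ne'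
        simp [h]
      right_inv := fun x => by
        have h : (r : ℝ) ≠ 0 := r.2.ne'
        simp [h]
      map_mul' := fun x y => by
        simp [mul_add, ofAdd_add] }
  map_one' := by
    ext x
    simp
  map_mul' r s := by
    ext x
    simp [mul_assoc]

/-- The group `ℝ ⋊ ℝ⁺`, with product `(x, y)(x', y') = (x + y x', y y')`. -/
abbrev AffGroup : Type := Multiplicative ℝ ⋊[scalingAction] {r : ℝ // 0 < r}

namespace AffGroup

/-- The coordinate `x` on `ℝ ⋊ ℝ⁺`. -/
def x (p : AffGroup) : ℝ := p.left.toAdd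

/-- The coordinate `y > 0` on `ℝ ⋊ ℝ⁺`. -/
def y (p : AffGroup) : ℝ := (p.right : ℝ)

/-- The global chart `p ↦ (x, y)`. Index `0` stands for `x` and index `1` for `y`. Tangent vectors
at any point are written `v 0 • ∂/∂x + v 1 • ∂/∂y`. -/
def coords (p : AffGroup) : Fin 2 → ℝ := ![p.x, p.y]

/-- The image of the chart, the upper half plane. -/
def chartDomain : Set (Fin 2 → ℝ) := {q | 0 < q 1}

theorem y_pos (p : AffGroup) : 0 < p.y := p.right.2

theorem coords_injective : Function.Injective coords := by
  intro p q h
  have h0 : p.x = q.x := by simpa [coords] using congrFun h 0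
  have h1 : p.y = q.y := by simpa [coords] using congrFun h 1
  exact SemidirectProduct.ext h0 (Subtype.ext h1)

theorem range_coords : Set.range coords = chartDomain := by
  ext q
  constructor
  · rintro ⟨p, rfl⟩
    simpa [coords, chartDomain] using p.y_pos
  · intro hq
    refine ⟨⟨Multiplicative.ofAdd (q 0), ⟨q 1, hq⟩⟩, ?_⟩
    ext i
    fin_cases i <;> simp [coords, x, y]

/-- The expression of a function on the group in the chart; it only matters on `chartDomain`,
and it is extended by `0` elsewhere. -/
def inChart (f : AffGroup → ℝ) : (Fin 2 → ℝ) → ℝ := Function.extend coords f 0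

theorem inChart_coords (f : AffGroup → ℝ) (p : AffGroup) : inChart f (coords p) = f p :=
  coords_injective.extend_apply f 0 p

/-- `f` is a smooth function on the group. -/
def IsSmooth (f : AffGroup → ℝ) : Prop := ContDiffOn ℝ ∞ (inChart f) chartDomain

/-- `∂f/∂x`. -/
def dx (f : AffGroup → ℝ) (p : AffGroup) : ℝ := partialDeriv 0 (inChart f) (coords p)

/-- `∂f/∂y`. -/
def dy (f : AffGroup → ℝ) (p : AffGroup) : ℝ := partialDeriv 1 (inChart f) (coords p)

/-- A function `F p v` on the tangent bundle of the group (such as a Finsler metric) is a Douglas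
metric: its Douglas tensor vanishes. The chart is global, so it is enough to use that one. -/
def IsDouglas (F : AffGroup → (Fin 2 → ℝ) → ℝ) : Prop :=
  IsDouglasOn chartDomain (fun q v => inChart (fun p => F p v) q)

/-- The vector field `e₁ = y ∂/∂y`. -/
def e₁ (p : AffGroup) : Fin 2 → ℝ := ![0, p.y]

/-- The vector field `e₂ = y ∂/∂x`. -/
def e₂ (p : AffGroup) : Fin 2 → ℝ := ![p.y, 0]

/-- The Riemannian metric `g = (dx² + dy²)/y²`, for which `e₁, e₂` are orthonormal. -/
def g (p : AffGroup) (v w : Fin 2 → ℝ) : ℝ := (v 0 * w 0 + v 1 * w 1) / p.y ^ 2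

/-- The vector field `X = a e₁ + b e₂`. -/
def X (a b : ℝ) (p : AffGroup) : Fin 2 → ℝ := a • e₁ p + b • e₂ p

/-- `F = α + β` with `α(v) = √g(v, v)` and `β(v) = g(X, v)`, where `X = a e₁ + b e₂`. -/
def randers (a b : ℝ) (p : AffGroup) (v : Fin 2 → ℝ) : ℝ := √(g p v v) + g p (X a b p) v

/-- The conformally related metric `F̃ = e^f F`. -/
def conformalRanders (a b : ℝ) (f : AffGroup → ℝ) (p : AffGroup) (v : Fin 2 → ℝ) : ℝ :=
  Real.exp (f p) * randers a b p v

/-! The frame and the metric are the left-invariant ones. -/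

/-- Left translation by `h`, in the chart. -/
def leftTranslation (h : AffGroup) (q : Fin 2 → ℝ) : Fin 2 → ℝ := ![h.x + h.y * q 0, h.y * q 1]

theorem coords_mul (h p : AffGroup) : coords (h * p) = leftTranslation h (coords p) := by
  ext i
  fin_cases i <;> simp [coords, leftTranslation, x, y, scalingAction]

theorem y_mul (h p : AffGroup) : (h * p).y = h.y * p.y := by
  simp [y]

theorem fderiv_leftTranslation (h : AffGroup) (q v : Fin 2 → ℝ) :
    fderiv ℝ (leftTranslation h) q v = h.y • v := by
  have key : leftTranslation h = fun q => (![h.x, 0] : Fin 2 → ℝ) + h.y • q := by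
    funext q
    ext i
    fin_cases i <;> simp [leftTranslation]
  have hd : HasFDerivAt (leftTranslation h)
      (h.y • ContinuousLinearMap.id ℝ (Fin 2 → ℝ)) q := by
    rw [key]
    exact ((hasFDerivAt_id q).const_smul h.y).const_add _
  rw [hd.fderiv]
  simp

theorem e₁_leftInvariant (h p : AffGroup) :
    fderiv ℝ (leftTranslation h) (coords p) (e₁ p) = e₁ (h * p) := by
  rw [fderiv_leftTranslation]
  simp [e₁, y_mul]

theorem e₂_leftInvariant (h p : AffGroup) :
    fderiv ℝ (leftTranslation h) (coords p) (e₂ p) = e₂ (h * p) := by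
  rw [fderiv_leftTranslation]
  simp [e₂, y_mul]

theorem g_leftInvariant (h p : AffGroup) (v w : Fin 2 → ℝ) :
    g (h * p) (fderiv ℝ (leftTranslation h) (coords p) v)
      (fderiv ℝ (leftTranslation h) (coords p) w) = g p v w := by
  have h1 := h.y_pos.ne'
  have h2 := p.y_pos.ne'
  simp only [fderiv_leftTranslation, g, y_mul, Pi.smul_apply, smul_eq_mul]
  field_simp

theorem g_orthonormal (p : AffGroup) :
    g p (e₁ p) (e₁ p) = 1 ∧ g p (e₂ p) (e₂ p) = 1 ∧ g p (e₁ p) (e₂ p) = 0 := by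
  have h2 := p.y_pos.ne'
  refine ⟨?_, ?_, ?_⟩ <;> simp [g, e₁, e₂] <;> field_simp

end AffGroup

end

/-! ### Coordinate partial derivatives and Euler's identity. -/

noncomputable section

open scoped Topology

/-! In the chart, `F̃ = φ(x) L(v)` with `φ = e^f / y` and `L(v) = |v| + ⟨c, v⟩`, where `c = (b, a)`
is constant: the hyperbolic metric is itself conformally flat, so all dependence on the point sits
in `φ`. Put `s = d log φ` and `τ = c₀ s₁ - c₁ s₀`.

The spray has the closed form `P v - ½ (⟨s, Jv⟩ + τ |v|) Jv`, with `J` the quarter turn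
(`sprayCoeff_conformal`). Its divergence is `3P + ½ ⟨s, v⟩` (`sum_partialDeriv_spray`), so `P` drops
out of the Douglas tensor. What remains, `projSpray`, is quadratic in `v` apart from `-½ τ |v| Jv`,
whose third derivatives do not all vanish unless `τ = 0` (`douglasTensor_eq_zero_iff`). Since `s =
(f_x, f_y - 1/y)`, the equation `τ = 0` multiplied by `y` is the stated one. -/

theorem HasFDerivAt.partialDeriv_eq {n : ℕ} {φ : (Fin n → ℝ) → ℝ} {x : Fin n → ℝ}
    {φ' : (Fin n → ℝ) →L[ℝ] ℝ} (h : HasFDerivAt φ φ' x) (i : Fin n) :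
    partialDeriv i φ x = φ' (Pi.single i 1) := by
  rw [partialDeriv, h.fderiv]

theorem Filter.EventuallyEq.partialDeriv_eq {n : ℕ} {φ ψ : (Fin n → ℝ) → ℝ} {x : Fin n → ℝ}
    (h : φ =ᶠ[𝓝 x] ψ) (i : Fin n) : partialDeriv i φ x = partialDeriv i ψ x := by
  rw [partialDeriv, partialDeriv, h.fderiv_eq]

theorem partialDeriv_const_mul {n : ℕ} {φ : (Fin n → ℝ) → ℝ} {x : Fin n → ℝ}
    (h : DifferentiableAt ℝ φ x) (a : ℝ) (i : Fin n) :
    partialDeriv i (fun z => a * φ z) x = a * partialDeriv i φ x := by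
  rw [(h.hasFDerivAt.const_mul a).partialDeriv_eq]
  rfl

theorem fderiv_apply_eq_sum_partialDeriv {n : ℕ} (φ : (Fin n → ℝ) → ℝ) (x v : Fin n → ℝ) :
    fderiv ℝ φ x v = ∑ m, partialDeriv m φ x * v m := by
  conv_lhs => rw [pi_eq_sum_univ' v]
  simp [partialDeriv, mul_comm]

/-- Euler's identity for functions homogeneous of degree one. -/
theorem sum_partialDeriv_mul_of_homogeneous {n : ℕ} {φ : (Fin n → ℝ) → ℝ} {v : Fin n → ℝ}
    (hd : DifferentiableAt ℝ φ v) (hh : ∀ t : ℝ, 0 < t → φ (t • v) = t * φ v) :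
    ∑ m, partialDeriv m φ v * v m = φ v := by
  rw [← fderiv_apply_eq_sum_partialDeriv]
  have h1 : HasDerivAt (fun t : ℝ => φ (t • v)) (fderiv ℝ φ v v) 1 := by
    have hs : HasDerivAt (fun t : ℝ => t • v) v 1 := by
      simpa using (hasDerivAt_id (1 : ℝ)).smul_const v
    have hd' : HasFDerivAt φ (fderiv ℝ φ v) ((1 : ℝ) • v) := by simpa using hd.hasFDerivAt
    exact hd'.comp_hasDerivAt 1 hs
  have h2 : HasDerivAt (fun t : ℝ => φ (t • v)) (φ v) 1 := by
    have : HasDerivAt (fun t : ℝ => t * φ v) (φ v) 1 := by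
      simpa using (hasDerivAt_id (1 : ℝ)).mul_const (φ v)
    refine this.congr_of_eventuallyEq ?_
    filter_upwards [lt_mem_nhds (zero_lt_one' ℝ)] with t ht using hh t ht
  exact h1.unique h2

/-! ### The Randers norm of the plane and its Hessian. -/

namespace PlaneRanders

/-- The Euclidean norm of the plane. -/
def nrm (v : Fin 2 → ℝ) : ℝ := √(v 0 ^ 2 + v 1 ^ 2)

/-- Rotation by a quarter turn. -/
def rot (v : Fin 2 → ℝ) : Fin 2 → ℝ := ![-v 1, v 0]

/-- The Euclidean inner product of the plane. -/
def ip (v w : Fin 2 → ℝ) : ℝ := v 0 * w 0 + v 1 * w 1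

/-- The translation-invariant Randers norm of the plane with one-form `c`. -/
def rnorm (c v : Fin 2 → ℝ) : ℝ := nrm v + ip c v

theorem sq_add_sq_pos {v : Fin 2 → ℝ} (hv : v ≠ 0) : 0 < v 0 ^ 2 + v 1 ^ 2 := by
  by_contra h
  apply hv
  have h0 : v 0 = 0 := by nlinarith [sq_nonneg (v 0), sq_nonneg (v 1)]
  have h1 : v 1 = 0 := by nlinarith [sq_nonneg (v 0), sq_nonneg (v 1)]
  ext i
  fin_cases i <;> simp [h0, h1]

theorem nrm_pos {v : Fin 2 → ℝ} (hv : v ≠ 0) : 0 < nrm v := Real.sqrt_pos.2 (sq_add_sq_pos hv)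

theorem nrm_sq (v : Fin 2 → ℝ) : nrm v ^ 2 = v 0 ^ 2 + v 1 ^ 2 := Real.sq_sqrt (by positivity)

theorem rnorm_pos {c v : Fin 2 → ℝ} (hc : c 0 ^ 2 + c 1 ^ 2 < 1) (hv : v ≠ 0) :
    0 < rnorm c v := by
  have h1 := nrm_pos hv
  have h2 := nrm_sq v
  have h3 : |ip c v| < nrm v := by
    refine abs_lt_of_sq_lt_sq ?_ h1.le
    rw [ip]
    -- Lagrange's identity `⟨c, v⟩² + (c₀ v₁ - c₁ v₀)² = |c|² |v|²`, together with `|c| < 1`.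
    nlinarith [sq_nonneg (c 0 * v 1 - c 1 * v 0), mul_pos (sub_pos.2 hc) (sq_add_sq_pos hv)]
  rw [rnorm]
  linarith [(abs_lt.1 h3).1]

theorem nrm_smul {t : ℝ} (ht : 0 < t) (v : Fin 2 → ℝ) : nrm (t • v) = t * nrm v := by
  rw [nrm, nrm, ← Real.sqrt_sq ht.le, ← Real.sqrt_mul (sq_nonneg _), Real.sqrt_sq ht.le]
  congr 1
  simp
  ring

theorem hasFDerivAt_coord (i : Fin 2) (v : Fin 2 → ℝ) :
    HasFDerivAt (fun w : Fin 2 → ℝ => w i) (ContinuousLinearMap.proj (R := ℝ) i) v :=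
  (ContinuousLinearMap.proj (R := ℝ) (φ := fun _ : Fin 2 => ℝ) i).hasFDerivAt

theorem hasFDerivAt_nrm {v : Fin 2 → ℝ} (hv : v ≠ 0) :
    HasFDerivAt nrm ((v 0 / nrm v) • ContinuousLinearMap.proj (R := ℝ) (φ := fun _ : Fin 2 => ℝ) 0
      + (v 1 / nrm v) • ContinuousLinearMap.proj (R := ℝ) (φ := fun _ : Fin 2 => ℝ) 1) v := by
  have h := (((hasFDerivAt_coord 0 v).pow 2).add ((hasFDerivAt_coord 1 v).pow 2)).sqrt
    (sq_add_sq_pos hv).ne'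
  refine h.congr_fderiv ?_
  have hN := (nrm_pos hv).ne'
  ext w
  change 1 / (2 * nrm v) * _ = _
  simp
  field_simp

theorem differentiableAt_nrm {v : Fin 2 → ℝ} (hv : v ≠ 0) : DifferentiableAt ℝ nrm v :=
  (hasFDerivAt_nrm hv).differentiableAt

theorem hasFDerivAt_rnorm (c : Fin 2 → ℝ) {v : Fin 2 → ℝ} (hv : v ≠ 0) :
    HasFDerivAt (rnorm c)
      ((v 0 / nrm v + c 0) • ContinuousLinearMap.proj (R := ℝ) (φ := fun _ : Fin 2 => ℝ) 0
      + (v 1 / nrm v + c 1) • ContinuousLinearMap.proj (R := ℝ) (φ := fun _ : Fin 2 => ℝ) 1) v := by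
  have h := (hasFDerivAt_nrm hv).add
    (((hasFDerivAt_coord 0 v).const_mul (c 0)).add ((hasFDerivAt_coord 1 v).const_mul (c 1)))
  refine h.congr_fderiv ?_
  ext w
  simp
  ring

theorem partialDeriv_rnorm_sq (c : Fin 2 → ℝ) {v : Fin 2 → ℝ} (hv : v ≠ 0) (i : Fin 2) :
    partialDeriv i (fun u => rnorm c u ^ 2) v = 2 * (rnorm c v * (v i / nrm v + c i)) := by
  rw [((hasFDerivAt_rnorm c hv).pow 2).partialDeriv_eq]
  fin_cases i <;> simp <;> ring

/-- Half of the Hessian of the square of the Randers norm. -/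
def hess (c v : Fin 2 → ℝ) : Matrix (Fin 2) (Fin 2) ℝ :=
  Matrix.of fun i j => rnorm c v * (rot v i * rot v j) / nrm v ^ 3
    + (v i / nrm v + c i) * (v j / nrm v + c j)

theorem eventually_ne_zero {v : Fin 2 → ℝ} (hv : v ≠ 0) : ∀ᶠ w in 𝓝 v, w ≠ 0 :=
  isOpen_ne.mem_nhds hv

theorem partialDeriv_partialDeriv_rnorm_sq (c : Fin 2 → ℝ) {v : Fin 2 → ℝ} (hv : v ≠ 0)
    (i j : Fin 2) :
    partialDeriv i (fun w => partialDeriv j (fun u => rnorm c u ^ 2) w) v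
      = 2 * hess c v i j := by
  have hev : (fun w => partialDeriv j (fun u => rnorm c u ^ 2) w) =ᶠ[𝓝 v]
      fun w => 2 * (rnorm c w * (w j * (nrm w)⁻¹ + c j)) := by
    filter_upwards [eventually_ne_zero hv] with w hw
    rw [partialDeriv_rnorm_sq c hw, div_eq_mul_inv]
  have hN := (nrm_pos hv).ne'
  have hN2 := nrm_sq v
  have h := ((hasFDerivAt_rnorm c hv).mul
    (((hasFDerivAt_coord j v).mul ((hasDerivAt_inv hN).comp_hasFDerivAt v
      (hasFDerivAt_nrm hv))).add_const (c j))).const_mul 2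
  rw [hev.partialDeriv_eq]
  refine (h.partialDeriv_eq i).trans ?_
  fin_cases i <;> fin_cases j <;> simp [hess, rot] <;> field_simp <;> grind

/-! ### The spray of a conformal multiple, and its divergence. -/

/-- The projective factor of the spray of `φ(x) · rnorm c v`, where `s = d(log φ)`. -/
def projFactor (c s v : Fin 2 → ℝ) : ℝ :=
  (1 / 2) * (ip s v - ip (rot c) v * ip s (rot v) / nrm v
    - ip (rot c) v ^ 2 * ip s v / (nrm v * rnorm c v))

/-- The spray of `φ(x) · rnorm c v`, where `s = d(log φ)`. -/
def spray (c s : Fin 2 → ℝ) (i : Fin 2) (v : Fin 2 → ℝ) : ℝ :=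
  projFactor c s v * v i
    - (1 / 2) * (ip s (rot v) + (c 0 * s 1 - c 1 * s 0) * nrm v) * rot v i

/-- `hess` has the form `k r rᵀ + p pᵀ` with `r = rot v`, `k = L / |v|³` and `p = dL`, so its
determinant is `k (r ∧ p)²`; here `r ∧ p = -⟨v, p⟩ = -L` by Euler. -/
theorem det_hess (c : Fin 2 → ℝ) {v : Fin 2 → ℝ} (hv : v ≠ 0) :
    (hess c v).det = rnorm c v ^ 3 / nrm v ^ 3 := by
  have hN := (nrm_pos hv).ne'
  have hN2 := nrm_sq v
  rw [Matrix.det_fin_two]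
  simp only [hess, rot, rnorm, ip, Matrix.of_apply, Matrix.cons_val_zero, Matrix.cons_val_one]
  -- The square root becomes a variable `N` with `N ^ 2 = v 0 ^ 2 + v 1 ^ 2`; the claim is then
  -- polynomial modulo this relation.
  generalize nrm v = N at *
  field_simp
  grind

/-- The linear system defining the spray, with `φ²` divided out. Checking the candidate `spray`
against it avoids inverting the Hessian. -/
theorem hess_mulVec_spray {c : Fin 2 → ℝ} (hc : c 0 ^ 2 + c 1 ^ 2 < 1) (s : Fin 2 → ℝ)
    {v : Fin 2 → ℝ} (hv : v ≠ 0) (l : Fin 2) :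
    ∑ i, hess c v l i * spray c s i v
      = ip s v * (rnorm c v * (v l / nrm v + c l)) - (1 / 2) * (s l * rnorm c v ^ 2) := by
  have hN := (nrm_pos hv).ne'
  have hN2 := nrm_sq v
  have hL := (rnorm_pos hc hv).ne'
  have hLe : rnorm c v = nrm v + ip c v := rfl
  rw [Fin.sum_univ_two]
  simp only [hess, spray, projFactor, rot, ip, Matrix.of_apply, Matrix.cons_val_zero,
    Matrix.cons_val_one] at *
  generalize nrm v = N at *
  generalize rnorm c v = L at *
  fin_cases l <;> simp <;> field_simp <;> grind

theorem differentiableAt_projFactor {c : Fin 2 → ℝ} (hc : c 0 ^ 2 + c 1 ^ 2 < 1)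
    (s : Fin 2 → ℝ) {v : Fin 2 → ℝ} (hv : v ≠ 0) : DifferentiableAt ℝ (projFactor c s) v := by
  have h1 := differentiableAt_nrm hv
  have h2 := (hasFDerivAt_rnorm c hv).differentiableAt
  have hN := (nrm_pos hv).ne'
  have hL := (rnorm_pos hc hv).ne'
  have hNL := mul_ne_zero hN hL
  unfold projFactor ip rot
  simp only [Matrix.cons_val_zero, Matrix.cons_val_one]
  fun_prop (disch := assumption)

theorem projFactor_smul (c s v : Fin 2 → ℝ) {t : ℝ} (ht : 0 < t) :
    projFactor c s (t • v) = t * projFactor c s v := by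
  have h : rnorm c (t • v) = t * rnorm c v := by
    simp [rnorm, nrm_smul ht, ip]
    ring
  rw [projFactor, projFactor, h, nrm_smul ht]
  simp only [ip, rot, Pi.smul_apply, smul_eq_mul, Matrix.cons_val_zero, Matrix.cons_val_one]
  field_simp

/-- By Euler, `div (P v) = 2P + dP(v) = 3P`, so `P` never has to be differentiated explicitly. The
field `Jv` is divergence free and `|v|` is constant along it, so the other term contributes only `-½
⟨s, J²v⟩ = ½ ⟨s, v⟩`. -/
theorem sum_partialDeriv_spray {c : Fin 2 → ℝ} (hc : c 0 ^ 2 + c 1 ^ 2 < 1) (s : Fin 2 → ℝ)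
    {v : Fin 2 → ℝ} (hv : v ≠ 0) :
    ∑ m, partialDeriv m (spray c s m) v = 3 * projFactor c s v + (1 / 2) * ip s v := by
  have hN := (nrm_pos hv).ne'
  have hd := differentiableAt_projFactor hc s hv
  have euler := sum_partialDeriv_mul_of_homogeneous hd fun t ht => projFactor_smul c s v ht
  have hQ := (((hasFDerivAt_coord 1 v).neg.const_mul (s 0)).add
    ((hasFDerivAt_coord 0 v).const_mul (s 1))).add
      ((hasFDerivAt_nrm hv).const_mul (c 0 * s 1 - c 1 * s 0))
  have e0 := ((hd.hasFDerivAt.mul (hasFDerivAt_coord 0 v)).sub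
    ((hQ.const_mul (1 / 2)).mul (hasFDerivAt_coord 1 v).neg)).partialDeriv_eq 0
  have e1 := ((hd.hasFDerivAt.mul (hasFDerivAt_coord 1 v)).sub
    ((hQ.const_mul (1 / 2)).mul (hasFDerivAt_coord 0 v))).partialDeriv_eq 1
  rw [Fin.sum_univ_two] at euler ⊢
  refine (congrArg₂ (· + ·) e0 e1).trans ?_
  rw [partialDeriv, partialDeriv] at euler
  simp [ip] at euler ⊢
  field_simp
  linear_combination 2 * nrm v * euler

/-! ### Third derivatives of the projectively invariant part. -/

/-- The projectively invariant part of the spray, for `τ = c 0 * s 1 - c 1 * s 0`. -/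
def projSpray (s : Fin 2 → ℝ) (τ : ℝ) (i : Fin 2) (v : Fin 2 → ℝ) : ℝ :=
  -((1 / 2) * (ip s (rot v) + τ * nrm v) * rot v i) - (1 / 6) * ip s v * v i

theorem partialDeriv_quadratic (A B C : ℝ) (i : Fin 2) (v : Fin 2 → ℝ) :
    partialDeriv i (fun v => A * v 0 ^ 2 + B * (v 0 * v 1) + C * v 1 ^ 2) v
      = (![2 * A, B] i) * v 0 + (![B, 2 * C] i) * v 1 := by
  have h := ((((hasFDerivAt_coord 0 v).pow 2).const_mul A).add
    (((hasFDerivAt_coord 0 v).mul (hasFDerivAt_coord 1 v)).const_mul B)).add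
      (((hasFDerivAt_coord 1 v).pow 2).const_mul C)
  refine (h.partialDeriv_eq i).trans ?_
  fin_cases i <;> simp <;> ring

theorem partialDeriv_linear (A B : ℝ) (i : Fin 2) (v : Fin 2 → ℝ) :
    partialDeriv i (fun v => A * v 0 + B * v 1) v = ![A, B] i := by
  have h := ((hasFDerivAt_coord 0 v).const_mul A).add ((hasFDerivAt_coord 1 v).const_mul B)
  refine (h.partialDeriv_eq i).trans ?_
  fin_cases i <;> simp

theorem partialDeriv_const {n : ℕ} (A : ℝ) (i : Fin n) (v : Fin n → ℝ) :
    partialDeriv i (fun _ => A) v = 0 := by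
  simp [partialDeriv]

theorem projSpray_zero_eq_quadratic (s : Fin 2 → ℝ) (i : Fin 2) :
    ∃ A B C : ℝ, projSpray s 0 i = fun v => A * v 0 ^ 2 + B * (v 0 * v 1) + C * v 1 ^ 2 := by
  fin_cases i
  · refine ⟨(-1 / 6) * s 0, (1 / 3) * s 1, (-1 / 2) * s 0, ?_⟩
    ext v
    simp [projSpray, ip, rot]
    ring
  · refine ⟨(-1 / 2) * s 1, (1 / 3) * s 0, (-1 / 6) * s 1, ?_⟩
    ext v
    simp [projSpray, ip, rot]
    ring

theorem thirdDeriv_projSpray_zero (s : Fin 2 → ℝ) (i j k l : Fin 2) (v : Fin 2 → ℝ) :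
    partialDeriv j (fun v₁ => partialDeriv k (fun v₂ => partialDeriv l (projSpray s 0 i) v₂) v₁) v
      = 0 := by
  obtain ⟨A, B, C, h⟩ := projSpray_zero_eq_quadratic s i
  simp only [h, partialDeriv_quadratic, partialDeriv_linear, partialDeriv_const]

theorem partialDeriv_projSpray_zero_zero (s : Fin 2 → ℝ) (τ : ℝ) {v : Fin 2 → ℝ} (hv : v ≠ 0) :
    partialDeriv 0 (projSpray s τ 0) v
      = -(1 / 3) * s 0 * v 0 + (1 / 3) * s 1 * v 1 + (τ / 2) * (v 0 * v 1 * (nrm v)⁻¹) := by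
  have hN := (nrm_pos hv).ne'
  have hQ := ((((hasFDerivAt_coord 1 v).neg.const_mul (s 0)).add
    ((hasFDerivAt_coord 0 v).const_mul (s 1))).add ((hasFDerivAt_nrm hv).const_mul τ)).const_mul
      (1 / 2)
  have hR := (((hasFDerivAt_coord 0 v).const_mul (s 0)).add
    ((hasFDerivAt_coord 1 v).const_mul (s 1))).const_mul (1 / 6)
  have h := (hQ.mul (hasFDerivAt_coord 1 v).neg).neg.sub (hR.mul (hasFDerivAt_coord 0 v))
  refine (h.partialDeriv_eq 0).trans ?_
  simp
  field_simp
  ring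

theorem partialDeriv_partialDeriv_projSpray_zero_zero (s : Fin 2 → ℝ) (τ : ℝ) {v : Fin 2 → ℝ}
    (hv : v ≠ 0) :
    partialDeriv 0 (fun w => partialDeriv 0 (projSpray s τ 0) w) v
      = -(1 / 3) * s 0 + (τ / 2) * (v 1 ^ 3 * ((nrm v)⁻¹) ^ 3) := by
  have hN := (nrm_pos hv).ne'
  have hN2 := nrm_sq v
  have hev : (fun w => partialDeriv 0 (projSpray s τ 0) w) =ᶠ[𝓝 v] fun v =>
      -(1 / 3) * s 0 * v 0 + (1 / 3) * s 1 * v 1 + (τ / 2) * (v 0 * v 1 * (nrm v)⁻¹) := by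
    filter_upwards [eventually_ne_zero hv] with w hw
    exact partialDeriv_projSpray_zero_zero s τ hw
  rw [hev.partialDeriv_eq]
  have h := (((hasFDerivAt_coord 0 v).const_mul (-(1 / 3) * s 0)).add
    ((hasFDerivAt_coord 1 v).const_mul ((1 / 3) * s 1))).add
      ((((hasFDerivAt_coord 0 v).mul (hasFDerivAt_coord 1 v)).mul
        ((hasDerivAt_inv hN).comp_hasFDerivAt v (hasFDerivAt_nrm hv))).const_mul (τ / 2))
  refine (h.partialDeriv_eq 0).trans ?_
  simp
  field_simp
  grind

/-- A single component of the Douglas tensor, enough to detect `τ`. -/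
theorem thirdDeriv_projSpray_zero_zero (s : Fin 2 → ℝ) (τ : ℝ) {v : Fin 2 → ℝ} (hv : v ≠ 0) :
    partialDeriv 0 (fun v₁ => partialDeriv 0
      (fun v₂ => partialDeriv 0 (projSpray s τ 0) v₂) v₁) v
      = -(3 / 2) * τ * (v 0 * v 1 ^ 3 / nrm v ^ 5) := by
  have hN := (nrm_pos hv).ne'
  have hev : (fun v₁ => partialDeriv 0 (fun w => partialDeriv 0 (projSpray s τ 0) w) v₁)
      =ᶠ[𝓝 v] fun v => -(1 / 3) * s 0 + (τ / 2) * (v 1 ^ 3 * ((nrm v)⁻¹) ^ 3) := by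
    filter_upwards [eventually_ne_zero hv] with w hw
    exact partialDeriv_partialDeriv_projSpray_zero_zero s τ hw
  rw [hev.partialDeriv_eq]
  have h := ((((hasFDerivAt_coord 1 v).pow 3).mul
    (((hasDerivAt_inv hN).comp_hasFDerivAt v (hasFDerivAt_nrm hv)).pow 3)).const_mul
      (τ / 2)).const_add (-(1 / 3) * s 0)
  refine (h.partialDeriv_eq 0).trans ?_
  simp
  field_simp

/-! ### The Douglas tensor of a conformal multiple of a Randers norm. -/

section Conformal

variable {F : (Fin 2 → ℝ) → (Fin 2 → ℝ) → ℝ} {φ : (Fin 2 → ℝ) → ℝ} {c x : Fin 2 → ℝ}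

theorem differentiableAt_rnorm_sq (c : Fin 2 → ℝ) {v : Fin 2 → ℝ} (hv : v ≠ 0) :
    DifferentiableAt ℝ (fun u => rnorm c u ^ 2) v :=
  (hasFDerivAt_rnorm c hv).differentiableAt.pow 2

theorem partialDeriv_sq_conformal {z : Fin 2 → ℝ} (hF : ∀ v, F z v = φ z * rnorm c v)
    {v : Fin 2 → ℝ} (hv : v ≠ 0) (i : Fin 2) :
    partialDeriv i (fun u => F z u ^ 2) v
      = φ z ^ 2 * (2 * (rnorm c v * (v i / nrm v + c i))) := by
  simp only [hF, mul_pow]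
  rw [partialDeriv_const_mul (differentiableAt_rnorm_sq c hv), partialDeriv_rnorm_sq c hv]

theorem fundamentalTensor_conformal (hF : ∀ v, F x v = φ x * rnorm c v)
    {v : Fin 2 → ℝ} (hv : v ≠ 0) : fundamentalTensor F x v = φ x ^ 2 • hess c v := by
  ext i j
  have hev : (fun w => partialDeriv j (fun u => F x u ^ 2) w) =ᶠ[𝓝 v]
      fun w => φ x ^ 2 * partialDeriv j (fun u => rnorm c u ^ 2) w := by
    filter_upwards [eventually_ne_zero hv] with w hw
    rw [partialDeriv_sq_conformal hF hw, partialDeriv_rnorm_sq c hw]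
  have hev' : (fun w => partialDeriv j (fun u => rnorm c u ^ 2) w) =ᶠ[𝓝 v]
      fun w => 2 * (rnorm c w * (w j / nrm w + c j)) := by
    filter_upwards [eventually_ne_zero hv] with w hw using partialDeriv_rnorm_sq c hw j
  have h1 := differentiableAt_nrm hv
  have h2 := (hasFDerivAt_rnorm c hv).differentiableAt
  have hN := (nrm_pos hv).ne'
  have hd : DifferentiableAt ℝ (fun w => partialDeriv j (fun u => rnorm c u ^ 2) w) v := by
    refine DifferentiableAt.congr_of_eventuallyEq ?_ hev'
    fun_prop (disch := assumption)
  simp only [fundamentalTensor, Matrix.of_apply, Matrix.smul_apply, smul_eq_mul]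
  rw [hev.partialDeriv_eq, partialDeriv_const_mul hd, partialDeriv_partialDeriv_rnorm_sq c hv]
  ring

theorem partialDeriv_sq_mul_const (hφ : DifferentiableAt ℝ φ x) (E : ℝ) (k : Fin 2) :
    partialDeriv k (fun z => φ z ^ 2 * E) x = 2 * φ x * partialDeriv k φ x * E := by
  rw [((hφ.hasFDerivAt.pow 2).mul_const E).partialDeriv_eq, partialDeriv]
  simp
  ring

theorem sprayCoeff_conformal (hF : ∀ᶠ z in 𝓝 x, ∀ v, F z v = φ z * rnorm c v)
    (hφ : DifferentiableAt ℝ φ x) (hx : φ x ≠ 0) (hc : c 0 ^ 2 + c 1 ^ 2 < 1)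
    {v : Fin 2 → ℝ} (hv : v ≠ 0) (i : Fin 2) :
    sprayCoeff F i x v = spray c (fun k => partialDeriv k φ x / φ x) i v := by
  set s : Fin 2 → ℝ := fun k => partialDeriv k φ x / φ x with hs
  have hs' (k : Fin 2) : partialDeriv k φ x = φ x * s k := by rw [hs]; field_simp
  have hFx := hF.self_of_nhds
  have hw (l : Fin 2) : (∑ k, partialDeriv k (fun z => partialDeriv l (fun u => F z u ^ 2) v) x
      * v k) - partialDeriv l (fun z => F z v ^ 2) x
      = 4 * ((φ x ^ 2 • hess c v).mulVec (fun m => spray c s m v)) l := by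
    have e1 : (fun z => partialDeriv l (fun u => F z u ^ 2) v) =ᶠ[𝓝 x]
        fun z => φ z ^ 2 * (2 * (rnorm c v * (v l / nrm v + c l))) := by
      filter_upwards [hF] with z hz using partialDeriv_sq_conformal hz hv l
    have e2 : (fun z => F z v ^ 2) =ᶠ[𝓝 x] fun z => φ z ^ 2 * rnorm c v ^ 2 := by
      filter_upwards [hF] with z hz
      rw [hz, mul_pow]
    have key := hess_mulVec_spray hc s hv l
    rw [e2.partialDeriv_eq, partialDeriv_sq_mul_const hφ, hs']
    simp only [e1.partialDeriv_eq, partialDeriv_sq_mul_const hφ, hs']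
    rw [Matrix.smul_mulVec, Pi.smul_apply, Matrix.mulVec, dotProduct, key, Fin.sum_univ_two, ip,
      smul_eq_mul]
    ring
  have hdet : IsUnit (φ x ^ 2 • hess c v).det := by
    rw [Matrix.det_smul, det_hess c hv, isUnit_iff_ne_zero]
    have hN := (nrm_pos hv).ne'
    have hL := (rnorm_pos hc hv).ne'
    positivity
  rw [sprayCoeff, fundamentalTensor_conformal hFx hv]
  simp only [hw]
  have h1 : (φ x ^ 2 • hess c v)⁻¹.mulVec ((φ x ^ 2 • hess c v).mulVec fun m => spray c s m v) i
      = spray c s i v := by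
    rw [Matrix.mulVec_mulVec, Matrix.nonsing_inv_mul _ hdet, Matrix.one_mulVec]
  rw [← h1, Matrix.mulVec, dotProduct, Finset.mul_sum]
  refine Finset.sum_congr rfl fun l _ => ?_
  ring

theorem douglasTensor_conformal (hF : ∀ᶠ z in 𝓝 x, ∀ v, F z v = φ z * rnorm c v)
    (hφ : DifferentiableAt ℝ φ x) (hx : φ x ≠ 0) (hc : c 0 ^ 2 + c 1 ^ 2 < 1)
    {s : Fin 2 → ℝ} (hs : ∀ k, partialDeriv k φ x = φ x * s k)
    {v : Fin 2 → ℝ} (hv : v ≠ 0) (i j k l : Fin 2) :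
    douglasTensor F i j k l x v = partialDeriv j (fun v₁ => partialDeriv k (fun v₂ =>
      partialDeriv l (projSpray s (c 0 * s 1 - c 1 * s 0) i) v₂) v₁) v := by
  obtain rfl : s = fun k => partialDeriv k φ x / φ x := by
    ext k
    rw [hs]
    field_simp
  set s : Fin 2 → ℝ := fun k => partialDeriv k φ x / φ x
  have hsp {w : Fin 2 → ℝ} (hw : w ≠ 0) (m : Fin 2) : sprayCoeff F m x w = spray c s m w :=
    sprayCoeff_conformal hF hφ hx hc hw m
  have h0 {w : Fin 2 → ℝ} (hw : w ≠ 0) : sprayCoeff F i x w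
      - (1 / (((2 : ℕ) : ℝ) + 1)) * (∑ m, partialDeriv m (fun u => sprayCoeff F m x u) w) * w i
      = projSpray s (c 0 * s 1 - c 1 * s 0) i w := by
    have e (m : Fin 2) : (fun u => sprayCoeff F m x u) =ᶠ[𝓝 w] spray c s m := by
      filter_upwards [eventually_ne_zero hw] with u hu using hsp hu m
    simp only [(e _).partialDeriv_eq]
    rw [sum_partialDeriv_spray hc s hw, hsp hw, spray, projSpray]
    push_cast
    ring
  -- The formulas hold only for nonzero vectors; these form an open set, so equality there survives
  -- each differentiation.
  have lift {φ ψ : (Fin 2 → ℝ) → ℝ} (h : ∀ w, w ≠ 0 → φ w = ψ w) (m : Fin 2) (w : Fin 2 → ℝ)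
      (hw : w ≠ 0) : partialDeriv m φ w = partialDeriv m ψ w := by
    refine Filter.EventuallyEq.partialDeriv_eq ?_ m
    filter_upwards [eventually_ne_zero hw] with u hu using h u hu
  exact lift (lift (lift (fun w hw => h0 hw) l) k) j v hv

theorem douglasTensor_eq_zero_iff (hF : ∀ᶠ z in 𝓝 x, ∀ v, F z v = φ z * rnorm c v)
    (hφ : DifferentiableAt ℝ φ x) (hx : φ x ≠ 0) (hc : c 0 ^ 2 + c 1 ^ 2 < 1)
    {s : Fin 2 → ℝ} (hs : ∀ k, partialDeriv k φ x = φ x * s k) :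
    (∀ v : Fin 2 → ℝ, v ≠ 0 → ∀ i j k l : Fin 2, douglasTensor F i j k l x v = 0) ↔
      c 0 * s 1 - c 1 * s 0 = 0 := by
  constructor
  · intro h
    -- The component is a multiple of `τ * v 0 * v 1 ^ 3`, so both coordinates must be nonzero.
    have hv : (![1, 1] : Fin 2 → ℝ) ≠ 0 := fun h => by simpa using congrFun h 0
    have h1 := h _ hv 0 0 0 0
    rw [douglasTensor_conformal hF hφ hx hc hs hv, thirdDeriv_projSpray_zero_zero _ _ hv] at h1
    simpa [(nrm_pos hv).ne'] using h1
  · intro h v hv i j k l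
    rw [douglasTensor_conformal hF hφ hx hc hs hv, h, thirdDeriv_projSpray_zero]

end Conformal

end PlaneRanders

/-! ### The chart of the group and the conformal factor. -/

namespace AffGroup

theorem isOpen_chartDomain : IsOpen chartDomain :=
  isOpen_lt continuous_const (continuous_apply 1)

theorem coords_mem_chartDomain (p : AffGroup) : coords p ∈ chartDomain :=
  range_coords ▸ Set.mem_range_self p

/-- Both `α` and `β` scale as `1/y`, which moves into the conformal factor. The one-form is `![b,
a]`, in this order, because `e₂` points along `x` (index `0`) and `e₁` along `y`. -/
theorem inChart_conformalRanders (a b : ℝ) (f : AffGroup → ℝ) {q : Fin 2 → ℝ}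
    (hq : q ∈ chartDomain) (v : Fin 2 → ℝ) :
    inChart (fun p => conformalRanders a b f p v) q
      = Real.exp (inChart f q) * (q 1)⁻¹ * PlaneRanders.rnorm ![b, a] v := by
  obtain ⟨p, rfl⟩ := range_coords.symm ▸ hq
  have hy := p.y_pos
  rw [inChart_coords, inChart_coords]
  have h1 : √(g p v v) = PlaneRanders.nrm v / p.y := by
    rw [g, Real.sqrt_div' _ (by positivity), Real.sqrt_sq hy.le, PlaneRanders.nrm, pow_two, pow_two]
  rw [conformalRanders, randers, h1]
  simp [g, X, e₁, e₂, coords, PlaneRanders.rnorm, PlaneRanders.ip]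
  field_simp

theorem sq_add_sq_lt_one {a b : ℝ} {p : AffGroup} (h : √(g p (X a b p) (X a b p)) < 1) :
    b ^ 2 + a ^ 2 < 1 := by
  have hy := p.y_pos.ne'
  have h1 : g p (X a b p) (X a b p) = b ^ 2 + a ^ 2 := by
    simp [g, X, e₁, e₂]
    field_simp
  rwa [h1, Real.sqrt_lt' one_pos, one_pow] at h

theorem partialDeriv_conformalFactor {f : AffGroup → ℝ} {p : AffGroup}
    (hf : DifferentiableAt ℝ (inChart f) (coords p)) :
    DifferentiableAt ℝ (fun q : Fin 2 → ℝ => Real.exp (inChart f q) * (q 1)⁻¹) (coords p) ∧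
    ∀ k, partialDeriv k (fun q : Fin 2 → ℝ => Real.exp (inChart f q) * (q 1)⁻¹) (coords p)
      = Real.exp (inChart f (coords p)) * (coords p 1)⁻¹ * (![dx f p, dy f p - p.y⁻¹] k) := by
  have hy : coords p 1 ≠ 0 := p.y_pos.ne'
  have h := hf.hasFDerivAt.exp.mul
    (HasDerivAt.comp_hasFDerivAt (f := fun q : Fin 2 → ℝ => q 1) (coords p) (hasDerivAt_inv hy)
      (PlaneRanders.hasFDerivAt_coord 1 (coords p)))
  refine ⟨h.differentiableAt, fun k => (h.partialDeriv_eq k).trans ?_⟩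
  have hy' : coords p 1 = p.y := rfl
  have hp := p.y_pos.ne'
  fin_cases k <;> simp [dx, dy, partialDeriv, hy'] <;> field_simp <;> ring

end AffGroup

end

theorem proposition4p3 (a b : ℝ)
    (hX : ∀ p : AffGroup, √(AffGroup.g p (AffGroup.X a b p) (AffGroup.X a b p)) < 1)
    (f : AffGroup → ℝ) (hf : AffGroup.IsSmooth f) :
    AffGroup.IsDouglas (AffGroup.conformalRanders a b f) ↔
      ∀ p : AffGroup, b * p.y * AffGroup.dy f p - a * p.y * AffGroup.dx f p = b := by
  have key (p : AffGroup) : (∀ v : Fin 2 → ℝ, v ≠ 0 → ∀ i j k l : Fin 2,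
      douglasTensor (fun q v => AffGroup.inChart (fun p => AffGroup.conformalRanders a b f p v) q)
        i j k l p.coords v = 0) ↔
      b * p.y * AffGroup.dy f p - a * p.y * AffGroup.dx f p = b := by
    have hnhds : AffGroup.chartDomain ∈ nhds p.coords :=
      AffGroup.isOpen_chartDomain.mem_nhds p.coords_mem_chartDomain
    have hy := p.y_pos.ne'
    have hd : DifferentiableAt ℝ (AffGroup.inChart f) p.coords :=
      (hf.contDiffAt hnhds).differentiableAt (by simp)
    obtain ⟨h1, h2⟩ := AffGroup.partialDeriv_conformalFactor hd
    rw [PlaneRanders.douglasTensor_eq_zero_iff (c := ![b, a])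
      (s := ![AffGroup.dx f p, AffGroup.dy f p - p.y⁻¹])
      (Filter.mem_of_superset hnhds fun q hq => AffGroup.inChart_conformalRanders a b f hq)
      h1 (mul_ne_zero (Real.exp_ne_zero _) (inv_ne_zero hy))
      (AffGroup.sq_add_sq_lt_one (hX p)) h2]
    simp only [Matrix.cons_val_zero, Matrix.cons_val_one]
    -- The equation `b (f_y - 1/y) - a f_x = 0` is cleared of `y ≠ 0`.
    field_simp
    constructor <;> intro h <;> linarith
  constructor
  · exact fun h p => (key p).1 (h _ p.coords_mem_chartDomain)
  · intro h q hq
    obtain ⟨p, rfl⟩ := AffGroup.range_coords.symm ▸ hq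
    exact (key p).2 (h p)
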